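/- Let $c_1,c_3,r_2,r_4,\tau>0$ and put $a_1=2\pi c_3\frac{2c_1}{c_1+c_3}$, $a_2=2\pi c_3\frac{c_1-c_3}{c_1+c_3}$, \[ A=\begin{pmatrix}-a_1r_2&0\\0&-(a_1-a_2)r_4\end{pmatrix},\quad B=\begin{pmatrix}0&-a_1r_4\\-a_1r_2&0\end{pmatrix},\quad C=\begin{pmatrix}0&0\\0&-a_2r_4\end{pmatrix}, \] \[ \Delta(s)=sI-A-Be^{-\tau s}-Ce^{-2\tau s}\quad(s\in\mathbb C), \] \[ M=\frac{a_1r_4}{g(0)}\begin{pmatrix}1&-1\\-\frac{r_2}{r_4}&\frac{r_2}{r_4}\end{pmatrix},\qquad g(0)=a_1(r_2+r_4)+2\tau a_1r_2r_4(a_1-a_2). \] Then $M$ has rank one, and for every $t\in\mathbb R$ the function $s\mapsto e^{st}\Delta(s)^{-1}$ has a simple pole at $s=0$ with residue $M$. Let moreover $\phi\in C([-2\tau,0],\mathbb R^2)$, and let $h:[0,\infty)\to\mathbb R^2$ be exponentially bounded, i.e., there are constants $K_1>0$, $\beta>0$ such that $\|h(t)\|\le K_1e^{-\beta t}$ for all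 $t\ge 0$. Let $x$ be a solution of \[ \dot x(t)=Ax(t)+Bx(t-\tau)+Cx(t-2\tau)+h(t),\quad t\ge 0,\qquad x(\theta)=\phi(\theta),\quad -2\tau\le\theta\le 0, \] where $x$ is locally absolutely continuous on $[0,\infty)$ and the equation holds for almost every $t>0$ (for continuous $h$ this covers the classical solution). Then $h$ is integrable on $(0,\infty)$ and \[ \lim_{t\to\infty}x(t)=M\left[\phi(0)+B\int_0^\tau\phi(\theta-\tau)\,d\theta+C\int_0^{2\tau}\phi(\theta-2\tau)\,d\theta+\int_0^\infty h(\theta)\,d\theta\right]. \] -/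

import Mathlib

open Filter Topology MeasureTheory Set
open scoped Matrix

noncomputable section

namespace TwoLayer

/-- `a₁ = 2π c₃ · 2c₁ / (c₁ + c₃)`. -/
def a₁ (c₁ c₃ : ℝ) : ℝ := 2 * Real.pi * c₃ * (2 * c₁ / (c₁ + c₃))

/-- `a₂ = 2π c₃ · (c₁ - c₃) / (c₁ + c₃)`. -/
def a₂ (c₁ c₃ : ℝ) : ℝ := 2 * Real.pi * c₃ * ((c₁ - c₃) / (c₁ + c₃))

/-- Coefficient matrix of the undelayed term. -/
def matA (c₁ c₃ r₂ r₄ : ℝ) : Matrix (Fin 2) (Fin 2) ℝ :=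
  !![-(a₁ c₁ c₃ * r₂), 0;
     0, -((a₁ c₁ c₃ - a₂ c₁ c₃) * r₄)]

/-- Coefficient matrix of the term with delay `τ`. -/
def matB (c₁ c₃ r₂ r₄ : ℝ) : Matrix (Fin 2) (Fin 2) ℝ :=
  !![0, -(a₁ c₁ c₃ * r₄);
     -(a₁ c₁ c₃ * r₂), 0]

/-- Coefficient matrix of the term with delay `2τ`. -/
def matC (c₁ c₃ r₄ : ℝ) : Matrix (Fin 2) (Fin 2) ℝ :=
  !![0, 0;
     0, -(a₂ c₁ c₃ * r₄)]

/-- `x` solves `x'(t) = A x(t) + B x(t - τ) + C x(t - 2τ) + h(t)` for `t ≥ 0` with `x = φ` on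
`[-2τ, 0]`. The source `h` need not be continuous, so the equation is understood in the sense of
Carathéodory: `x` is absolutely continuous on every `[0, T]` and satisfies the equation for almost
every `t > 0`. For bounded `h` this includes every continuous `x` that satisfies the equation
pointwise. -/
structure IsSolution (c₁ c₃ r₂ r₄ τ : ℝ) (φ h x : ℝ → Fin 2 → ℝ) : Prop where
  initial : ∀ θ ∈ Icc (-(2 * τ)) 0, x θ = φ θ
  absCont : ∀ T : ℝ, 0 ≤ T → AbsolutelyContinuousOnInterval x 0 T
  equation : ∀ᵐ t ∂(volume.restrict (Ioi (0 : ℝ))),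
    HasDerivAt x
      (matA c₁ c₃ r₂ r₄ *ᵥ x t + matB c₁ c₃ r₂ r₄ *ᵥ x (t - τ)
        + matC c₁ c₃ r₄ *ᵥ x (t - 2 * τ) + h t) t

/-- The characteristic matrix `Δ(s) = s I - A - B e^{-τ s} - C e^{-2 τ s}`. -/
def charMatrix (c₁ c₃ r₂ r₄ τ : ℝ) (s : ℂ) : Matrix (Fin 2) (Fin 2) ℂ :=
  s • (1 : Matrix (Fin 2) (Fin 2) ℂ)
    - (matA c₁ c₃ r₂ r₄).map Complex.ofReal
    - Complex.exp (-(τ * s)) • (matB c₁ c₃ r₂ r₄).map Complex.ofReal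
    - Complex.exp (-(2 * τ * s)) • (matC c₁ c₃ r₄).map Complex.ofReal

/-- `f` has at `z` at most a simple pole, with residue `R`: near `z`, off `z`, one has
`f(s) = G(s) / (s - z)` with `G` analytic at `z` and `G(z) = R`. -/
def HasSimplePoleResidue (f : ℂ → Matrix (Fin 2) (Fin 2) ℂ) (z : ℂ)
    (R : Matrix (Fin 2) (Fin 2) ℂ) : Prop :=
  ∃ G : ℂ → Matrix (Fin 2) (Fin 2) ℂ,
    (∀ i j, AnalyticAt ℂ (fun s => G s i j) z) ∧ G z = R ∧
      ∀ᶠ s in 𝓝[≠] z, f s = (s - z)⁻¹ • G s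

/-- `g(0) = a₁ (r₂ + r₄) + 2 τ a₁ r₂ r₄ (a₁ - a₂)`. -/
def g₀ (c₁ c₃ r₂ r₄ τ : ℝ) : ℝ :=
  a₁ c₁ c₃ * (r₂ + r₄) + 2 * τ * a₁ c₁ c₃ * r₂ * r₄ * (a₁ c₁ c₃ - a₂ c₁ c₃)

/-- The matrix `M = G(0)`. -/
def matM (c₁ c₃ r₂ r₄ τ : ℝ) : Matrix (Fin 2) (Fin 2) ℝ :=
  (a₁ c₁ c₃ * r₄ / g₀ c₁ c₃ r₂ r₄ τ) •
    !![1, -1;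
       -(r₂ / r₄), r₂ / r₄]

end TwoLayer

end

/-! ### Absolutely continuous functions -/

namespace TwoLayer

/-! The limit is found by an energy argument, without Laplace inversion or any knowledge of the
other roots of `det Δ`. Write `x = (u, v)`, `a = a₁`, `b = a₁ - a₂`, `p = r₂`, `q = r₄`. Without
forcing, `p u(t-τ)² + q v(t)² + b q² ∫_{t-2τ}^t v²` has derivative exactly `-2a (p u(t-τ) + q (v(t)
+ v(t-2τ))/2)² - (b - a/2) q² (v(t) - v(t-2τ))²`. Both squares have positive weight because `a <
2b`, which is `a₁_lt`. A decreasing exponential weight absorbs the forcing (`energy_deriv`), so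
solutions are bounded, hence Lipschitz, and both squares are integrable. Barbalat's lemma sends
their bases to zero; the equation then gives `u', v' → 0` and `p u + q v → 0`.

This confines the limit to the line of equilibria. The point on it is selected by `firstIntegral`,
whose derivative is `k - l`, the difference of the two forcing components. Since `u` and `v` vary
slowly, each window integral is asymptotic to its length times the current value, so a 2×2 linear
system determines the limit.

The residue is a separate computation: `Δ⁻¹ = adj Δ / det Δ`, and `det Δ` has a simple zero at `0`
with derivative `g(0)`. Rank one makes the residue nonzero, so the pole is genuine. -/

/-- Translates of absolutely continuous functions are absolutely continuous. -/
theorem absolutelyContinuousOnInterval_comp_sub {X : Type*} [PseudoMetricSpace X] {f : ℝ → X}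
    {s t c : ℝ} (hf : AbsolutelyContinuousOnInterval f (s - c) (t - c)) :
    AbsolutelyContinuousOnInterval (fun r => f (r - c)) s t := by
  rw [absolutelyContinuousOnInterval_iff] at hf ⊢
  intro ε hε
  obtain ⟨δ, hδ, H⟩ := hf ε hε
  refine ⟨δ, hδ, fun E hE hEδ => ?_⟩
  refine H (E.1, fun i => ((E.2 i).1 - c, (E.2 i).2 - c)) ⟨fun i hi => ?_, ?_⟩ ?_
  · have := hE.1 i hi
    simp only [mem_uIcc] at this ⊢
    grind
  · intro i hi j hj hij
    have := hE.2 hi hj hij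
    simp only [Function.onFun, Set.disjoint_left, mem_uIoc] at this ⊢
    intro r hr hr'
    refine this (a := r + c) ?_ ?_
    · grind
    · grind
  · simpa [Real.dist_eq] using hEδ

/-- A function that agrees with an absolutely continuous function on the interval is absolutely
continuous. -/
theorem absolutelyContinuousOnInterval_congr {X : Type*} [PseudoMetricSpace X] {f g : ℝ → X}
    {s t : ℝ} (hf : AbsolutelyContinuousOnInterval f s t) (hfg : EqOn g f (uIcc s t)) :
    AbsolutelyContinuousOnInterval g s t := by
  rw [absolutelyContinuousOnInterval_iff] at hf ⊢
  intro ε hε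
  obtain ⟨δ, hδ, H⟩ := hf ε hε
  refine ⟨δ, hδ, fun E hE hEδ => ?_⟩
  refine lt_of_eq_of_lt (Finset.sum_congr rfl fun i hi => ?_) (H E hE hEδ)
  rw [hfg (hE.1 i hi).1, hfg (hE.1 i hi).2]

/-- Components of absolutely continuous functions are absolutely continuous. -/
theorem absolutelyContinuousOnInterval_apply {ι : Type*} [Fintype ι] {f : ℝ → ι → ℝ} {s t : ℝ}
    (hf : AbsolutelyContinuousOnInterval f s t) (i : ι) :
    AbsolutelyContinuousOnInterval (fun r => f r i) s t := by
  rw [absolutelyContinuousOnInterval_iff] at hf ⊢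
  intro ε hε
  obtain ⟨δ, hδ, H⟩ := hf ε hε
  refine ⟨δ, hδ, fun E hE hEδ => ?_⟩
  exact lt_of_le_of_lt (Finset.sum_le_sum fun j _ => dist_le_pi_dist _ _ i) (H E hE hEδ)

/-- An absolutely continuous function is the integral of its almost everywhere derivative. -/
theorem sub_eq_integral_of_ae_hasDerivAt {f f' : ℝ → ℝ} {s t : ℝ} (hst : s ≤ t)
    (hf : AbsolutelyContinuousOnInterval f s t)
    (hf' : ∀ᵐ r, r ∈ Ioc s t → HasDerivAt f (f' r) r) :
    f t - f s = ∫ r in s..t, f' r := by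
  rw [← hf.integral_deriv_eq_sub]
  refine intervalIntegral.integral_congr_ae ?_
  filter_upwards [hf'] with r hr hrs
  rw [uIoc_of_le hst] at hrs
  exact (hr hrs).deriv

/-- The increment of an absolutely continuous function is at most the integral of any integrable
upper bound of its derivative. -/
theorem sub_le_integral_of_ae_hasDerivAt_le {f f' g : ℝ → ℝ} {s t : ℝ} (hst : s ≤ t)
    (hf : AbsolutelyContinuousOnInterval f s t) (hg : IntervalIntegrable g volume s t)
    (hf' : ∀ᵐ r, r ∈ Ioc s t → HasDerivAt f (f' r) r ∧ f' r ≤ g r) :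
    f t - f s ≤ ∫ r in s..t, g r := by
  rw [← hf.integral_deriv_eq_sub]
  rw [intervalIntegral.integral_of_le hst, intervalIntegral.integral_of_le hst]
  refine integral_mono_ae hf.intervalIntegrable_deriv.1 hg.1 ?_
  rw [EventuallyLE, ae_restrict_iff' measurableSet_Ioc]
  filter_upwards [hf'] with r hr hrs
  rw [(hr hrs).1.deriv]
  exact (hr hrs).2

/-- Mean value inequality for absolutely continuous functions. -/
theorem abs_sub_le_of_ae_hasDerivAt {f f' : ℝ → ℝ} {s t L : ℝ} (hst : s ≤ t)
    (hf : AbsolutelyContinuousOnInterval f s t)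
    (hf' : ∀ᵐ r, r ∈ Ioc s t → HasDerivAt f (f' r) r ∧ |f' r| ≤ L) :
    |f t - f s| ≤ L * (t - s) := by
  have h1 := sub_le_integral_of_ae_hasDerivAt_le (f' := f') (g := fun _ => L) hst hf
    (by simp) (by
      filter_upwards [hf'] with r hr hrs
      exact ⟨(hr hrs).1, (abs_le.1 (hr hrs).2).2⟩)
  have h2 := sub_le_integral_of_ae_hasDerivAt_le (f := -f) (f' := -f') (g := fun _ => L) hst hf.neg
    (by simp) (by
      filter_upwards [hf'] with r hr hrs
      refine ⟨(hr hrs).1.neg, ?_⟩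
      have := (abs_le.1 (hr hrs).2).1
      simp only [Pi.neg_apply]; linarith)
  simp only [intervalIntegral.integral_const, smul_eq_mul, Pi.neg_apply] at h1 h2
  rw [abs_le]; constructor <;> linarith

/-! ### Barbalat's lemma and slowly varying functions -/

/-- **Barbalat's lemma** for a Lipschitz function whose square is dissipated by a nonnegative
functional. -/
theorem tendsto_zero_of_lipschitz_of_integral_sq_le {f Φ : ℝ → ℝ} {T c L : ℝ} (hc : 0 < c)
    (hL : 0 < L) (hcont : Continuous f)
    (hlip : ∀ s t, T ≤ s → s ≤ t → |f t - f s| ≤ L * (t - s))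
    (hΦ : ∀ t, T ≤ t → 0 ≤ Φ t)
    (hdiss : ∀ s t, T ≤ s → s ≤ t → c * ∫ r in s..t, f r ^ 2 ≤ Φ s - Φ t) :
    Tendsto f atTop (𝓝 0) := by
  have hmono : ∀ s t, T ≤ s → s ≤ t → Φ t ≤ Φ s := fun s t hs hst => by
    have h0 : 0 ≤ ∫ r in s..t, f r ^ 2 :=
      intervalIntegral.integral_nonneg hst fun r _ => sq_nonneg _
    have := hdiss s t hs hst
    have := mul_nonneg hc.le h0
    linarith
  obtain ⟨m, hm⟩ : ∃ m, Tendsto (fun t => Φ (max T t)) atTop (𝓝 m) := by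
    have hanti : Antitone fun t => Φ (max T t) := fun s t hst =>
      hmono _ _ (le_max_left _ _) (max_le_max le_rfl hst)
    refine ⟨_, tendsto_atTop_ciInf hanti ⟨0, ?_⟩⟩
    rintro _ ⟨t, rfl⟩
    exact hΦ _ (le_max_left _ _)
  rw [Metric.tendsto_atTop]
  intro ε hε
  -- If `|f t| ≥ ε`, the Lipschitz bound keeps `|f| ≥ ε/2` on `[t, t + δ]`. This costs `Φ` at least
  -- `c δ (ε/2)²`, which is impossible once `Φ` has nearly settled at its limit.
  set δ := ε / (2 * L) with hδ
  have hδ0 : 0 < δ := by positivity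
  have hdiff : Tendsto (fun t => Φ (max T t) - Φ (max T (t + δ))) atTop (𝓝 0) := by
    have := hm.sub (hm.comp (tendsto_atTop_add_const_right _ δ tendsto_id))
    simpa using this
  have hev := hdiff.eventually (gt_mem_nhds (show 0 < c * (δ * (ε / 2) ^ 2) by positivity))
  obtain ⟨N, hN⟩ := eventually_atTop.1 (hev.and (eventually_ge_atTop T))
  refine ⟨N, fun t ht => ?_⟩
  obtain ⟨h1, hTt⟩ := hN t ht
  rw [max_eq_right hTt, max_eq_right (by linarith)] at h1
  by_contra! hcon
  rw [Real.dist_eq, sub_zero] at hcon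
  have hint : δ * (ε / 2) ^ 2 ≤ ∫ r in t..(t + δ), f r ^ 2 := by
    have : ∫ _ in t..(t + δ), (ε / 2) ^ 2 ≤ ∫ r in t..(t + δ), f r ^ 2 := by
      refine intervalIntegral.integral_mono_on (by linarith) (by simp)
        ((hcont.pow 2).intervalIntegrable _ _) fun r hr => ?_
      have h2 := hlip t r hTt hr.1
      have h3 : L * (r - t) ≤ ε / 2 := by
        calc L * (r - t) ≤ L * δ := by gcongr; linarith [hr.2]
          _ = ε / 2 := by rw [hδ]; field_simp
      have h4 : ε / 2 ≤ |f r| := by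
        have := abs_sub_abs_le_abs_sub (f t) (f r)
        rw [abs_sub_comm] at this
        linarith
      rw [← sq_abs (f r)]
      gcongr
    simpa using this
  have := hdiss t (t + δ) hTt (by linarith)
  have := mul_le_mul_of_nonneg_left hint hc.le
  linarith

/-- If the almost everywhere derivative of `f` tends to zero, so do the increments of `f` over
windows of a fixed length, uniformly. -/
theorem eventually_abs_sub_le_of_deriv_tendsto_zero {f f' : ℝ → ℝ}
    (hac : ∀ t, 0 ≤ t → AbsolutelyContinuousOnInterval f 0 t)
    (hd : ∀ᵐ t, 0 < t → HasDerivAt f (f' t) t) (hf' : Tendsto f' atTop (𝓝 0))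
    {c ε : ℝ} (hc : 0 < c) (hε : 0 < ε) :
    ∀ᶠ t in atTop, ∀ s ∈ Icc (t - c) t, |f s - f t| ≤ ε := by
  have hev : ∀ᶠ r in atTop, |f' r| ≤ ε / c := by
    have := hf'.abs.eventually (ge_mem_nhds (show |(0 : ℝ)| < ε / c by simpa using by positivity))
    exact this
  obtain ⟨N, hN⟩ := eventually_atTop.1 hev
  -- The extra `c` keeps the whole window `[t - c, t]` where the derivative exists almost everywhere
  -- and is small.
  filter_upwards [eventually_ge_atTop (max N 0 + c)] with t ht s hs
  have hN' := le_max_left N 0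
  have h0 := le_max_right N 0
  have hs0 : max N 0 ≤ s := by linarith [hs.1]
  rw [abs_sub_comm]
  refine (abs_sub_le_of_ae_hasDerivAt (f' := f') (L := ε / c) hs.2 ?_ ?_).trans ?_
  · refine (hac t (by linarith)).mono ?_
    rw [uIcc_of_le hs.2, uIcc_of_le (by linarith)]
    exact Icc_subset_Icc (by linarith) le_rfl
  · filter_upwards [hd] with r hr hrs
    exact ⟨hr (by linarith [hrs.1]), hN r (by linarith [hrs.1])⟩
  · calc ε / c * (t - s) ≤ ε / c * c := by gcongr; linarith [hs.1]
      _ = ε := by field_simp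

theorem tendsto_sub_of_deriv_tendsto_zero {f f' : ℝ → ℝ}
    (hac : ∀ t, 0 ≤ t → AbsolutelyContinuousOnInterval f 0 t)
    (hd : ∀ᵐ t, 0 < t → HasDerivAt f (f' t) t) (hf' : Tendsto f' atTop (𝓝 0))
    {c : ℝ} (hc : 0 < c) : Tendsto (fun t => f (t - c) - f t) atTop (𝓝 0) := by
  rw [Metric.tendsto_nhds]
  intro ε hε
  filter_upwards [eventually_abs_sub_le_of_deriv_tendsto_zero hac hd hf' hc (half_pos hε)]
    with t ht
  have := ht (t - c) ⟨le_rfl, by linarith⟩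
  rw [Real.dist_eq, sub_zero]
  linarith

theorem tendsto_integral_sub_of_deriv_tendsto_zero {f f' : ℝ → ℝ} (hcont : Continuous f)
    (hac : ∀ t, 0 ≤ t → AbsolutelyContinuousOnInterval f 0 t)
    (hd : ∀ᵐ t, 0 < t → HasDerivAt f (f' t) t) (hf' : Tendsto f' atTop (𝓝 0))
    {c : ℝ} (hc : 0 < c) :
    Tendsto (fun t => (∫ r in (t - c)..t, f r) - c * f t) atTop (𝓝 0) := by
  rw [Metric.tendsto_nhds]
  intro ε hε
  filter_upwards [eventually_abs_sub_le_of_deriv_tendsto_zero hac hd hf' hc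
    (show 0 < ε / (2 * c) by positivity)] with t ht
  have heq : (∫ r in (t - c)..t, f r) - c * f t = ∫ r in (t - c)..t, (f r - f t) := by
    rw [intervalIntegral.integral_sub (hcont.intervalIntegrable _ _) (by simp)]
    simp
  rw [Real.dist_eq, sub_zero, heq]
  have := intervalIntegral.norm_integral_le_of_norm_le_const (a := t - c) (b := t)
    (f := fun r => f r - f t) (C := ε / (2 * c)) (by
      intro r hr
      rw [uIoc_of_le (by linarith)] at hr
      exact ht r ⟨hr.1.le, hr.2⟩)
  rw [Real.norm_eq_abs] at this
  refine this.trans_lt ?_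
  rw [sub_sub_cancel, abs_of_pos hc]
  have : ε / (2 * c) * c = ε / 2 := by field_simp
  linarith

end TwoLayer

/-! ### The scalar system and its Lyapunov functional -/

namespace TwoLayer

/-- The two components `u`, `v` of a forced solution, extended continuously to `ℝ`, with forcing
terms `k`, `l` of size at most `K e^{-βt}`. -/
structure ScalarSystem (a b p q τ β K : ℝ) (u v k l : ℝ → ℝ) : Prop where
  ha : 0 < a
  hab : a < 2 * b
  hp : 0 < p
  hq : 0 < q
  hτ : 0 < τ
  hβ : 0 < β
  hK : 0 < K
  contU : Continuous u
  contV : Continuous v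
  acU : ∀ t, 0 ≤ t → AbsolutelyContinuousOnInterval u 0 t
  acV : ∀ t, 0 ≤ t → AbsolutelyContinuousOnInterval v 0 t
  boundK : ∀ t, 0 ≤ t → |k t| ≤ K * Real.exp (-(β * t))
  boundL : ∀ t, 0 ≤ t → |l t| ≤ K * Real.exp (-(β * t))
  derivU : ∀ᵐ t, 0 < t → HasDerivAt u (-(a * p) * u t - a * q * v (t - τ) + k t) t
  derivV : ∀ᵐ t, 0 < t → HasDerivAt v
    (-(b * q) * v t - a * p * u (t - τ) - (a - b) * q * v (t - 2 * τ) + l t) t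

namespace ScalarSystem

variable {a b p q τ β K : ℝ} {u v k l : ℝ → ℝ}

theorem hb (S : ScalarSystem a b p q τ β K u v k l) : 0 < b := by
  linarith [S.ha, S.hab]

/-- The energy samples `u` at `t - τ`. Translation preserves null sets, so the exceptional set of
the equation may be shifted. -/
theorem derivU_shift (S : ScalarSystem a b p q τ β K u v k l) : ∀ᵐ t, τ < t →
    HasDerivAt (fun r => u (r - τ))
      (-(a * p) * u (t - τ) - a * q * v (t - 2 * τ) + k (t - τ)) t := by
  have h := (measurePreserving_sub_right (volume : Measure ℝ) τ).quasiMeasurePreserving.ae S.derivU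
  filter_upwards [h] with t ht hτt
  have := (ht (by linarith)).comp_sub_const t τ
  rwa [show t - τ - τ = t - 2 * τ by ring] at this

/-- The damped energy: a Lyapunov functional for the forced system. -/
noncomputable def energy (b p q τ β K : ℝ) (u v : ℝ → ℝ) (t : ℝ) : ℝ :=
  (p + q + p * (u (t - τ) * u (t - τ)) + q * (v t * v t)
    + b * q ^ 2 * ((∫ r in (0 : ℝ)..t, v r ^ 2) - ∫ r in (0 : ℝ)..(t - 2 * τ), v r ^ 2))
    * Real.exp (K / β * Real.exp (-(β * (t - τ))))

/-- The dissipation rate of the energy. -/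
noncomputable def dissipation (a b p q τ : ℝ) (u v : ℝ → ℝ) (t : ℝ) : ℝ :=
  2 * a * (p * u (t - τ) + q * (v t + v (t - 2 * τ)) / 2) ^ 2
    + (b - a / 2) * q ^ 2 * (v t - v (t - 2 * τ)) ^ 2

theorem continuous_dissipation (S : ScalarSystem a b p q τ β K u v k l) :
    Continuous (dissipation a b p q τ u v) := by
  have hu := S.contU
  have hv := S.contV
  unfold dissipation
  fun_prop

theorem history_nonneg (S : ScalarSystem a b p q τ β K u v k l) (t : ℝ) :
    0 ≤ (∫ r in (0 : ℝ)..t, v r ^ 2) - ∫ r in (0 : ℝ)..(t - 2 * τ), v r ^ 2 := by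
  have hi : ∀ s t, IntervalIntegrable (fun r => v r ^ 2) volume s t := fun s t =>
    (S.contV.pow 2).intervalIntegrable s t
  rw [intervalIntegral.integral_interval_sub_left (hi _ _) (hi _ _)]
  exact intervalIntegral.integral_nonneg (by linarith [S.hτ]) fun r _ => sq_nonneg _

theorem le_energy (S : ScalarSystem a b p q τ β K u v k l) (t : ℝ) :
    p * u (t - τ) ^ 2 + q * v t ^ 2 ≤ energy b p q τ β K u v t := by
  have hp := S.hp
  have hq := S.hq
  have hN : 1 ≤ Real.exp (K / β * Real.exp (-(β * (t - τ)))) :=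
    Real.one_le_exp (by have := S.hK; have := S.hβ; positivity)
  have hh := mul_nonneg (show 0 ≤ b * q ^ 2 by have := S.hb; positivity) (S.history_nonneg t)
  unfold energy
  refine le_trans ?_ (le_mul_of_one_le_right ?_ hN)
  · nlinarith
  · have h1 : 0 ≤ p * (u (t - τ) * u (t - τ)) := mul_nonneg hp.le (mul_self_nonneg _)
    have h2 : 0 ≤ q * (v t * v t) := mul_nonneg hq.le (mul_self_nonneg _)
    linarith

theorem absolutelyContinuous_energy (S : ScalarSystem a b p q τ β K u v k l) {s t : ℝ}
    (hs : τ ≤ s) (hst : s ≤ t) :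
    AbsolutelyContinuousOnInterval (energy b p q τ β K u v) s t := by
  have hτ := S.hτ
  have hU : AbsolutelyContinuousOnInterval (fun r => u (r - τ)) s t := by
    refine absolutelyContinuousOnInterval_comp_sub ((S.acU (t - τ) (by linarith)).mono ?_)
    rw [uIcc_of_le (by linarith), uIcc_of_le (by linarith)]
    exact Icc_subset_Icc (by linarith) le_rfl
  have hV : AbsolutelyContinuousOnInterval v s t := by
    refine (S.acV t (by linarith)).mono ?_
    rw [uIcc_of_le (by linarith), uIcc_of_le (by linarith)]
    exact Icc_subset_Icc (by linarith) le_rfl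
  have hc : ∀ C : ℝ, AbsolutelyContinuousOnInterval (fun _ => C) s t := fun C =>
    (contDiff_const (n := 1)).contDiffOn.absolutelyContinuousOnInterval
  have hI : ∀ s t : ℝ, AbsolutelyContinuousOnInterval (fun x => ∫ r in (0 : ℝ)..x, v r ^ 2) s t := by
    intro s t
    refine ContDiffOn.absolutelyContinuousOnInterval (ContDiff.contDiffOn ?_)
    rw [contDiff_one_iff_deriv]
    have hd : ∀ x, HasDerivAt (fun x => ∫ r in (0 : ℝ)..x, v r ^ 2) (v x ^ 2) x := fun x =>
      (S.contV.pow 2).integral_hasStrictDerivAt 0 x |>.hasDerivAt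
    refine ⟨fun x => (hd x).differentiableAt, ?_⟩
    rw [show deriv (fun x => ∫ r in (0 : ℝ)..x, v r ^ 2) = fun x => v x ^ 2 from
      funext fun x => (hd x).deriv]
    exact S.contV.pow 2
  have hE : AbsolutelyContinuousOnInterval
      (fun r => Real.exp (K / β * Real.exp (-(β * (r - τ))))) s t := by
    refine ContDiffOn.absolutelyContinuousOnInterval (ContDiff.contDiffOn ?_)
    fun_prop
  have h1 := ((hc (p + q)).fun_add ((hU.fun_mul hU).const_mul p)).fun_add ((hV.fun_mul hV).const_mul q)
  have h2 := ((hI s t).fun_sub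
    (absolutelyContinuousOnInterval_comp_sub (c := 2 * τ) (hI (s - 2 * τ) (t - 2 * τ)))).const_mul
      (b * q ^ 2)
  exact (h1.fun_add h2).fun_mul hE

/-- Let `W` be the unweighted energy, including the constant `p + q`, and `κ = K e^{-β(t-τ)}`.
Completing squares turns the unforced part of `W'` into minus the dissipation. By Young's inequality
the forcing adds at most `κ W`, where `p + q` pays for the terms free of `u` and `v`. The weight `N`
satisfies `N' = -κ N`, which cancels `κ W`; then `N ≥ 1` permits dropping it from the dissipation.
-/
theorem energy_deriv (S : ScalarSystem a b p q τ β K u v k l) : ∀ᵐ t, τ < t →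
    ∃ e, HasDerivAt (energy b p q τ β K u v) e t ∧ e ≤ -dissipation a b p q τ u v t := by
  have hp := S.hp
  have hq := S.hq
  have hK := S.hK
  have hβ := S.hβ
  have hτ := S.hτ
  have hb := S.hb
  have ha := S.ha
  have hab := S.hab
  filter_upwards [S.derivU_shift, S.derivV] with t hu hv ht
  have hu := hu ht
  have hv := hv (by linarith)
  have hI : ∀ x, HasDerivAt (fun x => ∫ r in (0 : ℝ)..x, v r ^ 2) (v x ^ 2) x := fun x =>
    (S.contV.pow 2).integral_hasStrictDerivAt 0 x |>.hasDerivAt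
  have hE : HasDerivAt (fun r => Real.exp (K / β * Real.exp (-(β * (r - τ)))))
      (-(K * Real.exp (-(β * (t - τ)))) * Real.exp (K / β * Real.exp (-(β * (t - τ))))) t := by
    have h0 : HasDerivAt (fun r => -(β * (r - τ))) (-(β * 1)) t :=
      (((hasDerivAt_id t).sub_const τ).const_mul β).neg
    convert! (h0.exp.const_mul (K / β)).exp using 1
    field_simp
  have hW := (((hu.mul hu).const_mul p).const_add (p + q)).add ((hv.mul hv).const_mul q) |>.add
    (((hI t).sub ((hI (t - 2 * τ)).comp_sub_const t (2 * τ))).const_mul (b * q ^ 2))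
  refine ⟨_, hW.mul hE, ?_⟩
  have hk := S.boundK (t - τ) (by linarith)
  -- The forcing of `u` enters at time `t - τ`, so the weaker bound at that time serves for both
  -- components.
  have hl : |l t| ≤ K * Real.exp (-(β * (t - τ))) := by
    refine (S.boundL t (by linarith)).trans ?_
    gcongr
    linarith
  have hh := mul_nonneg (show 0 ≤ b * q ^ 2 by positivity) (S.history_nonneg t)
  have hN : 1 ≤ Real.exp (K / β * Real.exp (-(β * (t - τ)))) := Real.one_le_exp (by positivity)
  have hκ : 0 ≤ K * Real.exp (-(β * (t - τ))) := by positivity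
  simp only [Pi.add_apply, Pi.mul_apply, Pi.sub_apply]
  generalize Real.exp (K / β * Real.exp (-(β * (t - τ)))) = N at *
  generalize K * Real.exp (-(β * (t - τ))) = κ at *
  generalize b * q ^ 2 * ((∫ r in (0 : ℝ)..t, v r ^ 2) - ∫ r in (0 : ℝ)..(t - 2 * τ), v r ^ 2)
    = H at *
  have hD : 0 ≤ dissipation a b p q τ u v t := by
    unfold dissipation
    have : 0 ≤ b - a / 2 := by linarith
    positivity
  have young : ∀ x m : ℝ, |m| ≤ κ → 2 * (x * m) ≤ κ * (1 + x * x) := fun x m hm => by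
    have h1 : x * m ≤ |x| * κ := (le_abs_self _).trans (by rw [abs_mul]; gcongr)
    nlinarith [mul_nonneg hκ (sq_nonneg (|x| - 1)), sq_abs x]
  have y1 := mul_le_mul_of_nonneg_left (young (u (t - τ)) _ hk) hp.le
  have y2 := mul_le_mul_of_nonneg_left (young (v t) _ hl) hq.le
  have hκH := mul_nonneg hκ hh
  have key : ∀ W' W : ℝ, W' - κ * W ≤ -dissipation a b p q τ u v t →
      W' * N + W * (-κ * N) ≤ -dissipation a b p q τ u v t := fun W' W hW => by
    have := mul_le_mul_of_nonneg_right hW (zero_le_one.trans hN)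
    nlinarith
  refine key _ _ ?_
  unfold dissipation
  generalize u (t - τ) = y at *
  generalize v (t - 2 * τ) = z at *
  generalize v t = w at *
  nlinarith

theorem integral_dissipation_le (S : ScalarSystem a b p q τ β K u v k l) {s t : ℝ}
    (hs : τ ≤ s) (hst : s ≤ t) :
    ∫ r in s..t, dissipation a b p q τ u v r
      ≤ energy b p q τ β K u v s - energy b p q τ β K u v t := by
  have h := sub_le_integral_of_ae_hasDerivAt_le (f' := deriv (energy b p q τ β K u v))
    (g := fun r => -dissipation a b p q τ u v r) hst (S.absolutelyContinuous_energy hs hst)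
    (S.continuous_dissipation.neg.intervalIntegrable _ _) (by
      filter_upwards [S.energy_deriv] with r hr hrs
      obtain ⟨e, he, hle⟩ := hr (by linarith [hrs.1])
      rw [he.deriv]
      exact ⟨he, hle⟩)
  rw [intervalIntegral.integral_neg] at h
  linarith

theorem energy_le (S : ScalarSystem a b p q τ β K u v k l) {t : ℝ} (ht : τ ≤ t) :
    energy b p q τ β K u v t ≤ energy b p q τ β K u v τ := by
  have h := S.integral_dissipation_le le_rfl ht
  have : 0 ≤ ∫ r in τ..t, dissipation a b p q τ u v r := by
    refine intervalIntegral.integral_nonneg ht fun r _ => ?_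
    unfold dissipation
    have := S.ha
    have : 0 ≤ b - a / 2 := by linarith [S.hab]
    positivity
  linarith

/-! ### Boundedness and Lipschitz estimates -/

/-- Solutions are bounded. -/
theorem exists_bound (S : ScalarSystem a b p q τ β K u v k l) :
    ∃ C, 0 < C ∧ ∀ t, -(2 * τ) ≤ t → |u t| ≤ C ∧ |v t| ≤ C := by
  have hp := S.hp
  have hq := S.hq
  obtain ⟨C₁, h₁⟩ := isCompact_Icc.exists_bound_of_continuousOn (s := Icc (-(2 * τ)) τ)
    S.contU.continuousOn
  obtain ⟨C₂, h₂⟩ := isCompact_Icc.exists_bound_of_continuousOn (s := Icc (-(2 * τ)) τ)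
    S.contV.continuousOn
  set E := energy b p q τ β K u v τ
  have hU : ∀ t, 0 ≤ t → |u t| ≤ √(E / p) := fun t ht => by
    refine Real.abs_le_sqrt ?_
    rw [le_div_iff₀ hp]
    have h1 := S.le_energy (t + τ)
    have h2 := S.energy_le (t := t + τ) (by linarith)
    rw [add_sub_cancel_right] at h1
    nlinarith [mul_nonneg hq.le (sq_nonneg (v (t + τ)))]
  have hV : ∀ t, τ ≤ t → |v t| ≤ √(E / q) := fun t ht => by
    refine Real.abs_le_sqrt ?_
    rw [le_div_iff₀ hq]
    have h1 := S.le_energy t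
    have h2 := S.energy_le ht
    nlinarith [mul_nonneg hp.le (sq_nonneg (u (t - τ)))]
  refine ⟨max (max C₁ C₂) (max √(E / p) √(E / q)) + 1, ?_, fun t ht => ?_⟩
  · have : 0 ≤ √(E / p) := Real.sqrt_nonneg _
    have : √(E / p) ≤ max (max C₁ C₂) (max √(E / p) √(E / q)) := by simp
    linarith
  · have e1 : C₁ ≤ max (max C₁ C₂) (max √(E / p) √(E / q)) := by simp
    have e2 : C₂ ≤ max (max C₁ C₂) (max √(E / p) √(E / q)) := by simp
    have e3 : √(E / p) ≤ max (max C₁ C₂) (max √(E / p) √(E / q)) := by simp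
    have e4 : √(E / q) ≤ max (max C₁ C₂) (max √(E / p) √(E / q)) := by simp
    rcases le_total t τ with h | h
    · have := h₁ t ⟨ht, h⟩
      have := h₂ t ⟨ht, h⟩
      simp only [Real.norm_eq_abs] at *
      constructor <;> linarith
    · have := hU t (by linarith [S.hτ])
      have := hV t h
      constructor <;> linarith

/-- Solutions are Lipschitz on `[0, ∞)`. -/
theorem exists_lipschitz (S : ScalarSystem a b p q τ β K u v k l) :
    ∃ L, 0 < L ∧ ∀ s t, 0 ≤ s → s ≤ t →
      |u t - u s| ≤ L * (t - s) ∧ |v t - v s| ≤ L * (t - s) := by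
  obtain ⟨C, hC, hb⟩ := S.exists_bound
  have hτ := S.hτ
  have ha := S.ha
  have hp := S.hp
  have hq := S.hq
  have hK := S.hK
  have hb0 := S.hb
  have hexp : ∀ t, 0 ≤ t → K * Real.exp (-(β * t)) ≤ K := fun t ht =>
    mul_le_of_le_one_right hK.le (Real.exp_le_one_iff.2 (by have := S.hβ; nlinarith))
  have hmul : ∀ c x : ℝ, |x| ≤ C → |c * x| ≤ |c| * C := fun c x hx => by
    rw [abs_mul]; gcongr
  refine ⟨(|-(a * p)| * C + |a * q| * C + K) + (|-(b * q)| * C + |a * p| * C + |(a - b) * q| * C + K),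
    by positivity, fun s t hs hst => ⟨?_, ?_⟩⟩
  · refine abs_sub_le_of_ae_hasDerivAt
      (f' := fun t => -(a * p) * u t - a * q * v (t - τ) + k t) hst ?_ ?_
    · refine (S.acU t (by linarith)).mono ?_
      rw [uIcc_of_le (by linarith), uIcc_of_le (by linarith)]
      exact Icc_subset_Icc (by linarith) le_rfl
    · filter_upwards [S.derivU] with r hr hrs
      have hr0 : 0 < r := by linarith [hrs.1]
      refine ⟨hr hr0, ?_⟩
      have h1 := hmul (-(a * p)) _ (hb r (by linarith)).1
      have h2 := hmul (a * q) _ (hb (r - τ) (by linarith)).2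
      have h3 := (S.boundK r hr0.le).trans (hexp r hr0.le)
      have h4 := abs_add_le (-(a * p) * u r - a * q * v (r - τ)) (k r)
      have h5 := abs_sub (-(a * p) * u r) (a * q * v (r - τ))
      have : 0 ≤ |-(b * q)| * C + |a * p| * C + |(a - b) * q| * C + K := by positivity
      linarith
  · refine abs_sub_le_of_ae_hasDerivAt
      (f' := fun t => -(b * q) * v t - a * p * u (t - τ) - (a - b) * q * v (t - 2 * τ) + l t)
      hst ?_ ?_
    · refine (S.acV t (by linarith)).mono ?_
      rw [uIcc_of_le (by linarith), uIcc_of_le (by linarith)]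
      exact Icc_subset_Icc (by linarith) le_rfl
    · filter_upwards [S.derivV] with r hr hrs
      have hr0 : 0 < r := by linarith [hrs.1]
      refine ⟨hr hr0, ?_⟩
      have h1 := hmul (-(b * q)) _ (hb r (by linarith)).2
      have h2 := hmul (a * p) _ (hb (r - τ) (by linarith)).1
      have h2' := hmul ((a - b) * q) _ (hb (r - 2 * τ) (by linarith)).2
      have h3 := (S.boundL r hr0.le).trans (hexp r hr0.le)
      have h4 := abs_add_le
        (-(b * q) * v r - a * p * u (r - τ) - (a - b) * q * v (r - 2 * τ)) (l r)
      have h5 := abs_sub (-(b * q) * v r - a * p * u (r - τ)) ((a - b) * q * v (r - 2 * τ))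
      have h6 := abs_sub (-(b * q) * v r) (a * p * u (r - τ))
      have : 0 ≤ |-(a * p)| * C + |a * q| * C + K := by positivity
      linarith

theorem energy_nonneg (S : ScalarSystem a b p q τ β K u v k l) (t : ℝ) :
    0 ≤ energy b p q τ β K u v t := by
  refine le_trans ?_ (S.le_energy t)
  have := S.hp
  have := S.hq
  positivity

/-! ### Decay of the dissipated quantities and of the derivatives -/

theorem tendsto_sub_delay (S : ScalarSystem a b p q τ β K u v k l) :
    Tendsto (fun t => v t - v (t - 2 * τ)) atTop (𝓝 0) := by
  obtain ⟨L, hL, hlip⟩ := S.exists_lipschitz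
  have hτ := S.hτ
  have hu := S.contU
  have hv := S.contV
  have hc : 0 < (b - a / 2) * q ^ 2 := by
    have := S.hq
    have : 0 < b - a / 2 := by linarith [S.hab]
    positivity
  -- Starting at `2τ` keeps every delayed argument in `[0, ∞)`, where the Lipschitz bound holds.
  refine tendsto_zero_of_lipschitz_of_integral_sq_le (T := 2 * τ) (L := 2 * L) hc (by positivity)
    (by fun_prop) (fun s t hs hst => ?_) (fun t _ => S.energy_nonneg t) (fun s t hs hst => ?_)
  · have h1 := (hlip s t (by linarith) hst).2
    have h2 := (hlip (s - 2 * τ) (t - 2 * τ) (by linarith) (by linarith)).2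
    rw [abs_le] at *
    constructor <;> nlinarith
  · refine le_trans ?_ (S.integral_dissipation_le (by linarith) hst)
    rw [← intervalIntegral.integral_const_mul]
    refine intervalIntegral.integral_mono_on hst (Continuous.intervalIntegrable (by fun_prop) _ _)
      (S.continuous_dissipation.intervalIntegrable _ _) fun r _ => ?_
    unfold dissipation
    have := S.ha
    have : 0 ≤ 2 * a * (p * u (r - τ) + q * (v r + v (r - 2 * τ)) / 2) ^ 2 := by positivity
    linarith

theorem tendsto_balance (S : ScalarSystem a b p q τ β K u v k l) :
    Tendsto (fun t => p * u (t - τ) + q * (v t + v (t - 2 * τ)) / 2) atTop (𝓝 0) := by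
  obtain ⟨L, hL, hlip⟩ := S.exists_lipschitz
  have hτ := S.hτ
  have hu := S.contU
  have hv := S.contV
  have hp := S.hp
  have hq := S.hq
  -- The constant is `p L + q (L + L)/2`.
  refine tendsto_zero_of_lipschitz_of_integral_sq_le (T := 2 * τ) (L := (p + q) * L)
    (show 0 < 2 * a by linarith [S.ha]) (by positivity)
    (by fun_prop) (fun s t hs hst => ?_) (fun t _ => S.energy_nonneg t) (fun s t hs hst => ?_)
  · have h1 := (hlip s t (by linarith) hst).2
    have h2 := (hlip (s - 2 * τ) (t - 2 * τ) (by linarith) (by linarith)).2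
    have h3 := (hlip (s - τ) (t - τ) (by linarith) (by linarith)).1
    rw [sub_sub_sub_cancel_right] at h2 h3
    rw [abs_le] at *
    constructor <;> nlinarith
  · refine le_trans ?_ (S.integral_dissipation_le (by linarith) hst)
    rw [← intervalIntegral.integral_const_mul]
    refine intervalIntegral.integral_mono_on hst (Continuous.intervalIntegrable (by fun_prop) _ _)
      (S.continuous_dissipation.intervalIntegrable _ _) fun r _ => ?_
    unfold dissipation
    have : 0 ≤ b - a / 2 := by linarith [S.hab]
    have : 0 ≤ (b - a / 2) * q ^ 2 * (v r - v (r - 2 * τ)) ^ 2 := by positivity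
    linarith

theorem tendsto_forcing {m : ℝ → ℝ} (hβ : 0 < β)
    (hm : ∀ t, 0 ≤ t → |m t| ≤ K * Real.exp (-(β * t))) : Tendsto m atTop (𝓝 0) := by
  have h : Tendsto (fun t => K * Real.exp (-(β * t))) atTop (𝓝 0) := by
    have := (Real.tendsto_exp_neg_atTop_nhds_zero.comp (tendsto_id.const_mul_atTop hβ)).const_mul K
    simpa using this
  exact squeeze_zero_norm' ((eventually_ge_atTop 0).mono fun t ht => hm t ht) h

/-- The right-hand side is a linear combination of the two dissipated quantities plus decaying
forcing. -/
theorem tendsto_derivV (S : ScalarSystem a b p q τ β K u v k l) :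
    Tendsto (fun t => -(b * q) * v t - a * p * u (t - τ) - (a - b) * q * v (t - 2 * τ) + l t)
      atTop (𝓝 0) := by
  have h := ((S.tendsto_balance.const_mul (-a)).add
    (S.tendsto_sub_delay.const_mul (q * (a / 2 - b)))).add (tendsto_forcing S.hβ S.boundL)
  simp only [mul_zero, add_zero] at h
  refine h.congr fun t => ?_
  ring

/-- The same decomposition, with the dissipated quantities taken at `t + τ`, where they contain `u
t` and `v (t - τ)`. -/
theorem tendsto_derivU (S : ScalarSystem a b p q τ β K u v k l) :
    Tendsto (fun t => -(a * p) * u t - a * q * v (t - τ) + k t) atTop (𝓝 0) := by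
  have hs : Tendsto (fun t : ℝ => t + τ) atTop atTop := tendsto_atTop_add_const_right _ τ tendsto_id
  have h := (((S.tendsto_balance.comp hs).const_mul (-a)).add
    ((S.tendsto_sub_delay.comp hs).const_mul (q * (a / 2)))).add (tendsto_forcing S.hβ S.boundK)
  simp only [mul_zero, add_zero] at h
  refine h.congr fun t => ?_
  simp only [Function.comp_apply, add_sub_cancel_right]
  rw [show t + τ - 2 * τ = t - τ by ring]
  ring

/-- The first equation expresses `p u(t) + q v(t-τ)` through `u'` and `k`, both of which vanish at
infinity; as `v' → 0`, the delay can then be removed. -/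
theorem tendsto_weighted_sum (S : ScalarSystem a b p q τ β K u v k l) :
    Tendsto (fun t => p * u t + q * v t) atTop (𝓝 0) := by
  have h := ((S.tendsto_derivU.sub (tendsto_forcing S.hβ S.boundK)).const_mul (-a⁻¹)).sub
    ((tendsto_sub_of_deriv_tendsto_zero S.acV S.derivV S.tendsto_derivV S.hτ).const_mul q)
  simp only [mul_zero, sub_zero] at h
  refine h.congr fun t => ?_
  have := S.ha.ne'
  field_simp
  ring

/-! ### The first integral and the limit -/

/-- The conserved quantity of the unforced system. -/
noncomputable def firstIntegral (a b p q τ : ℝ) (u v : ℝ → ℝ) (t : ℝ) : ℝ :=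
  u t - v t + a * p * (∫ r in (t - τ)..t, u r) - a * q * (∫ r in (t - τ)..t, v r)
    + (a - b) * q * ∫ r in (t - 2 * τ)..t, v r

/-- Subtracting the equations applies the left null vector `(1, -1)` of `Δ(0)`. The remaining
differences between current and delayed values are exactly cancelled by the derivatives of the
window integrals. -/
theorem firstIntegral_sub (S : ScalarSystem a b p q τ β K u v k l) {t : ℝ} (ht : 0 ≤ t) :
    firstIntegral a b p q τ u v t - firstIntegral a b p q τ u v 0 = ∫ r in (0 : ℝ)..t, (k r - l r) := by
  have hprim : ∀ {w : ℝ → ℝ}, Continuous w → ∀ c : ℝ,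
      (∀ x, HasDerivAt (fun x => ∫ r in (x - c)..x, w r) (w x - w (x - c)) x) ∧
      AbsolutelyContinuousOnInterval (fun x => ∫ r in (x - c)..x, w r) 0 t := by
    intro w hw c
    have hi : ∀ s t, IntervalIntegrable w volume s t := fun s t => hw.intervalIntegrable s t
    have hd : ∀ x, HasDerivAt (fun x => ∫ r in (x - c)..x, w r) (w x - w (x - c)) x := by
      intro x
      have hI : ∀ x, HasDerivAt (fun x => ∫ r in (0 : ℝ)..x, w r) (w x) x := fun x =>
        (hw.integral_hasStrictDerivAt 0 x).hasDerivAt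
      have := (hI x).sub ((hI (x - c)).comp_sub_const x c)
      refine this.congr_of_eventuallyEq (Eventually.of_forall fun y => ?_)
      simp only [Pi.sub_apply]
      rw [intervalIntegral.integral_interval_sub_left (hi _ _) (hi _ _)]
    refine ⟨hd, ContDiffOn.absolutelyContinuousOnInterval (ContDiff.contDiffOn ?_)⟩
    rw [contDiff_one_iff_deriv]
    refine ⟨fun x => (hd x).differentiableAt, ?_⟩
    rw [show deriv (fun x => ∫ r in (x - c)..x, w r) = fun x => w x - w (x - c) from
      funext fun x => (hd x).deriv]
    fun_prop
  refine sub_eq_integral_of_ae_hasDerivAt ht ?_ ?_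
  · exact ((((S.acU t ht).fun_sub (S.acV t ht)).fun_add ((hprim S.contU τ).2.const_mul (a * p))).fun_sub
      ((hprim S.contV τ).2.const_mul (a * q))).fun_add
        ((hprim S.contV (2 * τ)).2.const_mul ((a - b) * q))
  · filter_upwards [S.derivU, S.derivV] with r hu hv hr
    have h := (((((hu hr.1).sub (hv hr.1)).add (((hprim S.contU τ).1 r).const_mul (a * p))).sub
      (((hprim S.contV τ).1 r).const_mul (a * q))).add
        (((hprim S.contV (2 * τ)).1 r).const_mul ((a - b) * q)))
    refine HasDerivAt.congr_deriv (f := firstIntegral a b p q τ u v) h ?_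
    ring

/-- Convergence of the solution, with its limit. -/
theorem tendsto_solution (S : ScalarSystem a b p q τ β K u v k l)
    (hk : IntegrableOn k (Ioi 0)) (hl : IntegrableOn l (Ioi 0)) :
    let J := firstIntegral a b p q τ u v 0 + ((∫ r in Ioi 0, k r) - ∫ r in Ioi 0, l r)
    let D := p + q + 2 * τ * p * q * b
    Tendsto u atTop (𝓝 (q * J / D)) ∧ Tendsto v atTop (𝓝 (-(p * J / D))) := by
  intro J D
  have hp := S.hp
  have hq := S.hq
  have hτ := S.hτ
  have hb := S.hb
  have hD : 0 < D := by positivity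
  have hJ : Tendsto (firstIntegral a b p q τ u v) atTop (𝓝 J) := by
    have h := intervalIntegral_tendsto_integral_Ioi 0 (hk.sub hl) tendsto_id
    have h2 : ∫ r in Ioi 0, (k r - l r) = (∫ r in Ioi 0, k r) - ∫ r in Ioi 0, l r :=
      integral_sub hk hl
    simp only [Pi.sub_apply] at h
    rw [h2] at h
    refine (h.const_add (firstIntegral a b p q τ u v 0)).congr' ?_
    filter_upwards [eventually_ge_atTop 0] with t ht
    rw [id, ← S.firstIntegral_sub ht]
    ring
  have h1 := tendsto_integral_sub_of_deriv_tendsto_zero S.contU S.acU S.derivU S.tendsto_derivU hτ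
  have h2 := tendsto_integral_sub_of_deriv_tendsto_zero S.contV S.acV S.derivV S.tendsto_derivV hτ
  have h3 := tendsto_integral_sub_of_deriv_tendsto_zero S.contV S.acV S.derivV S.tendsto_derivV
    (show 0 < 2 * τ by linarith)
  have hlin := ((hJ.sub (h1.const_mul (a * p))).add (h2.const_mul (a * q))).sub
    (h3.const_mul ((a - b) * q))
  have hU : Tendsto u atTop (𝓝 (q * J / D)) := by
    -- The multiplier is the coefficient of `v` in the limiting form of the first integral.
    -- Subtracting that multiple of `p u + q v` eliminates `v` and leaves `D u`.
    have h := ((hlin.const_mul q).sub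
      (S.tendsto_weighted_sum.const_mul (-1 + a * q * τ - 2 * τ * b * q))).div_const D
    simp only [mul_zero, sub_zero, add_zero] at h
    refine h.congr fun t => ?_
    rw [div_eq_iff hD.ne']
    simp only [firstIntegral, D]
    ring
  refine ⟨hU, ?_⟩
  have h := (S.tendsto_weighted_sum.sub (hU.const_mul p)).div_const q
  rw [show (0 - p * (q * J / D)) / q = -(p * J / D) by field_simp; ring] at h
  refine h.congr fun t => ?_
  field_simp
  ring

end ScalarSystem

end TwoLayer

/-! ### Signs of the coefficients, rank of `M`, and the residue -/

namespace TwoLayer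

theorem a₁_pos {c₁ c₃ : ℝ} (hc₁ : 0 < c₁) (hc₃ : 0 < c₃) : 0 < a₁ c₁ c₃ := by
  unfold a₁
  have := Real.pi_pos
  positivity

theorem a₁_sub_a₂ {c₁ c₃ : ℝ} (hc₁ : 0 < c₁) (hc₃ : 0 < c₃) :
    a₁ c₁ c₃ - a₂ c₁ c₃ = 2 * Real.pi * c₃ := by
  unfold a₁ a₂
  field_simp
  ring

theorem a₁_lt {c₁ c₃ : ℝ} (hc₁ : 0 < c₁) (hc₃ : 0 < c₃) :
    a₁ c₁ c₃ < 2 * (a₁ c₁ c₃ - a₂ c₁ c₃) := by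
  rw [a₁_sub_a₂ hc₁ hc₃]
  unfold a₁
  have h : 2 * c₁ / (c₁ + c₃) < 2 := by
    rw [div_lt_iff₀ (by positivity)]
    linarith
  have : 0 < 2 * Real.pi * c₃ := by have := Real.pi_pos; positivity
  nlinarith

theorem g₀_pos {c₁ c₃ r₂ r₄ τ : ℝ} (hc₁ : 0 < c₁) (hc₃ : 0 < c₃)
    (hr₂ : 0 < r₂) (hr₄ : 0 < r₄) (hτ : 0 < τ) : 0 < g₀ c₁ c₃ r₂ r₄ τ := by
  unfold g₀
  have h1 := a₁_pos hc₁ hc₃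
  have h2 : 0 < a₁ c₁ c₃ - a₂ c₁ c₃ := by linarith [a₁_lt hc₁ hc₃]
  positivity

theorem rank_matM {c₁ c₃ r₂ r₄ τ : ℝ} (hc₁ : 0 < c₁) (hc₃ : 0 < c₃)
    (hr₂ : 0 < r₂) (hr₄ : 0 < r₄) (hτ : 0 < τ) : (matM c₁ c₃ r₂ r₄ τ).rank = 1 := by
  have hg := g₀_pos hc₁ hc₃ hr₂ hr₄ hτ
  have ha := a₁_pos hc₁ hc₃
  -- The column factor spans the kernel of `Δ(0)`, the row factor its left kernel.
  have hM : matM c₁ c₃ r₂ r₄ τ =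
      Matrix.vecMulVec ((a₁ c₁ c₃ * r₄ / g₀ c₁ c₃ r₂ r₄ τ) • ![1, -(r₂ / r₄)]) ![1, -1] := by
    ext i j
    fin_cases i <;> fin_cases j <;> simp [matM, Matrix.vecMulVec_apply]
  refine le_antisymm (hM ▸ Matrix.rank_vecMulVec_le _ _) (Nat.one_le_iff_ne_zero.2 fun h0 => ?_)
  rw [Matrix.rank, Submodule.finrank_eq_zero, LinearMap.range_eq_bot] at h0
  have h00 : matM c₁ c₃ r₂ r₄ τ 0 0 = 0 := by
    have := congrFun (LinearMap.congr_fun h0 (Pi.single 0 1)) 0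
    simpa using this
  have : matM c₁ c₃ r₂ r₄ τ 0 0 = a₁ c₁ c₃ * r₄ / g₀ c₁ c₃ r₂ r₄ τ := by simp [matM]
  rw [this] at h00
  exact (show 0 < a₁ c₁ c₃ * r₄ / g₀ c₁ c₃ r₂ r₄ τ by positivity).ne' h00

theorem charMatrix_eq (c₁ c₃ r₂ r₄ τ : ℝ) (s : ℂ) :
    charMatrix c₁ c₃ r₂ r₄ τ s =
      !![s + a₁ c₁ c₃ * r₂, Complex.exp (-(τ * s)) * (a₁ c₁ c₃ * r₄);
        Complex.exp (-(τ * s)) * (a₁ c₁ c₃ * r₂),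
        s + (a₁ c₁ c₃ - a₂ c₁ c₃) * r₄ + Complex.exp (-(2 * τ * s)) * (a₂ c₁ c₃ * r₄)] := by
  ext i j
  fin_cases i <;> fin_cases j <;> simp [charMatrix, matA, matB, matC]

theorem hasDerivAt_det_charMatrix (c₁ c₃ r₂ r₄ τ : ℝ) :
    HasDerivAt (fun s => (charMatrix c₁ c₃ r₂ r₄ τ s).det) (g₀ c₁ c₃ r₂ r₄ τ) 0 := by
  have hE : ∀ c : ℂ, HasDerivAt (fun s : ℂ => Complex.exp (-(c * s))) (-c) 0 := fun c => by
    have := ((hasDerivAt_id (0 : ℂ)).const_mul c).neg.cexp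
    simpa using this
  have h := (((hasDerivAt_id (0 : ℂ)).add_const (a₁ c₁ c₃ * r₂ : ℂ)).mul
    (((hasDerivAt_id (0 : ℂ)).add_const ((a₁ c₁ c₃ - a₂ c₁ c₃) * r₄ : ℂ)).add
      ((hE (2 * τ)).mul_const (a₂ c₁ c₃ * r₄ : ℂ)))).sub
    (((hE τ).mul_const (a₁ c₁ c₃ * r₄ : ℂ)).mul ((hE τ).mul_const (a₁ c₁ c₃ * r₂ : ℂ)))
  refine (h.congr_of_eventuallyEq (Eventually.of_forall fun s => ?_)).congr_deriv ?_
  · simp [charMatrix_eq, Matrix.det_fin_two]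
  · simp [g₀]
    ring

theorem hasSimplePoleResidue_charMatrix_inv {c₁ c₃ r₂ r₄ τ : ℝ} (hc₁ : 0 < c₁) (hc₃ : 0 < c₃)
    (hr₂ : 0 < r₂) (hr₄ : 0 < r₄) (hτ : 0 < τ) (t : ℝ) :
    HasSimplePoleResidue (fun s => Complex.exp (s * t) • (charMatrix c₁ c₃ r₂ r₄ τ s)⁻¹) 0
      ((matM c₁ c₃ r₂ r₄ τ).map Complex.ofReal) := by
  set d : ℂ → ℂ := fun s => (charMatrix c₁ c₃ r₂ r₄ τ s).det with hd
  have hg : (g₀ c₁ c₃ r₂ r₄ τ : ℂ) ≠ 0 := by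
    exact_mod_cast (g₀_pos hc₁ hc₃ hr₂ hr₄ hτ).ne'
  have hd0 : d 0 = 0 := by
    simp [hd, charMatrix_eq, Matrix.det_fin_two]
    ring
  have hds : dslope d 0 0 = g₀ c₁ c₃ r₂ r₄ τ := by
    rw [dslope_same]
    exact (hasDerivAt_det_charMatrix c₁ c₃ r₂ r₄ τ).deriv
  have hda : AnalyticAt ℂ d 0 := by
    simp only [hd, charMatrix_eq, Matrix.det_fin_two_of]
    fun_prop
  have hga : AnalyticAt ℂ (dslope d 0) 0 := by
    obtain ⟨P, hP⟩ := hda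
    exact hP.has_fpower_series_dslope_fslope.analyticAt
  -- As `d 0 = 0`, `d s = s * dslope d 0 s`, and `dslope d 0` is analytic with value `g(0) ≠ 0` at
  -- `0`. The factor `e^{st}` is `1` there, so the residue does not depend on `t`.
  refine ⟨fun s => (Complex.exp (s * t) * (dslope d 0 s)⁻¹) • (charMatrix c₁ c₃ r₂ r₄ τ s).adjugate,
    fun i j => ?_, ?_, ?_⟩
  · have hadj : AnalyticAt ℂ (fun s => (charMatrix c₁ c₃ r₂ r₄ τ s).adjugate i j) 0 := by
      simp only [charMatrix_eq, Matrix.adjugate_fin_two_of]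
      fin_cases i <;> fin_cases j <;> simp <;> fun_prop
    have hinv := hga.inv (by rw [hds]; exact hg)
    have hexp : AnalyticAt ℂ (fun s : ℂ => Complex.exp (s * t)) 0 := by fun_prop
    exact (hexp.mul hinv).mul hadj
  · simp only [hds, charMatrix_eq, Matrix.adjugate_fin_two_of]
    have : (r₄ : ℂ) ≠ 0 := by exact_mod_cast hr₄.ne'
    ext i j
    fin_cases i <;> fin_cases j <;> simp [matM] <;> field_simp
    ring
  · have hne : ∀ᶠ s in 𝓝[≠] (0 : ℂ), dslope d 0 s ≠ 0 :=
      (hga.continuousAt.eventually_ne (by rw [hds]; exact hg)).filter_mono nhdsWithin_le_nhds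
    filter_upwards [hne, self_mem_nhdsWithin] with s hs hs0
    have hs0 : s ≠ 0 := hs0
    have hdet : (charMatrix c₁ c₃ r₂ r₄ τ s).det = s * dslope d 0 s := by
      have := sub_smul_dslope d 0 s
      rw [hd0] at this
      simpa using this.symm
    rw [Matrix.inv_def, hdet, Ring.inverse_eq_inv', smul_smul, smul_smul, sub_zero, mul_inv]
    congr 1
    ring

/-! ### From the vector equation to the scalar system -/

/-- A solution is continuous from the start of its initial interval on. -/
theorem IsSolution.continuousOn {c₁ c₃ r₂ r₄ τ : ℝ} {φ h x : ℝ → Fin 2 → ℝ} (hτ : 0 < τ)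
    (hφ : ContinuousOn φ (Icc (-(2 * τ)) 0)) (hx : IsSolution c₁ c₃ r₂ r₄ τ φ h x) :
    ContinuousOn x (Ici (-(2 * τ))) := by
  have h1 : ContinuousOn x (Icc (-(2 * τ)) 0) := hφ.congr hx.initial
  have h2 : ContinuousOn x (Ici 0) := by
    intro t ht
    have ht : 0 ≤ t := ht
    have := (hx.absCont (t + 1) (by linarith)).continuousOn
    rw [uIcc_of_le (by linarith)] at this
    refine (this t ⟨ht, by linarith⟩).mono_of_mem_nhdsWithin ?_
    rw [← Ici_inter_Iic]
    exact inter_mem self_mem_nhdsWithin (mem_nhdsWithin_of_mem_nhds (Iic_mem_nhds (by linarith)))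
  rw [← Icc_union_Ici_eq_Ici (show -(2 * τ) ≤ 0 by linarith)]
  exact h1.union_of_isClosed h2 isClosed_Icc isClosed_Ici

/-- The continuous extension of a solution to the left of its initial interval. -/
theorem IsSolution.continuous_extend {c₁ c₃ r₂ r₄ τ : ℝ} {φ h x : ℝ → Fin 2 → ℝ} (hτ : 0 < τ)
    (hφ : ContinuousOn φ (Icc (-(2 * τ)) 0)) (hx : IsSolution c₁ c₃ r₂ r₄ τ φ h x) :
    Continuous fun t => x (max t (-(2 * τ))) :=
  (hx.continuousOn hτ hφ).comp_continuous (by fun_prop) fun _ => mem_Ici.2 (le_max_right _ _)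

theorem IsSolution.integrableOn {c₁ c₃ r₂ r₄ τ K₁ β : ℝ} {φ h x : ℝ → Fin 2 → ℝ} (hτ : 0 < τ)
    (hφ : ContinuousOn φ (Icc (-(2 * τ)) 0)) (hβ : 0 < β)
    (hh : ∀ t, 0 ≤ t → ‖h t‖ ≤ K₁ * Real.exp (-(β * t)))
    (hx : IsSolution c₁ c₃ r₂ r₄ τ φ h x) : IntegrableOn h (Ioi 0) := by
  have hX := hx.continuous_extend hτ hφ
  set X : ℝ → Fin 2 → ℝ := fun t => x (max t (-(2 * τ))) with hXdef
  have hXx : ∀ t, -(2 * τ) ≤ t → X t = x t := fun t ht => by simp [hXdef, ht]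
  -- Measurability of `h` is not assumed; it follows from the equation, where `h` is almost
  -- everywhere `deriv x` minus a continuous function.
  have hmeas : AEStronglyMeasurable h (volume.restrict (Ioi 0)) := by
    have h1 : Continuous fun t => matA c₁ c₃ r₂ r₄ *ᵥ X t + matB c₁ c₃ r₂ r₄ *ᵥ X (t - τ)
        + matC c₁ c₃ r₄ *ᵥ X (t - 2 * τ) := by fun_prop
    refine ((stronglyMeasurable_deriv x).aestronglyMeasurable.sub
      h1.aestronglyMeasurable).congr ?_
    filter_upwards [hx.equation, ae_restrict_mem measurableSet_Ioi] with t ht ht0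
    have ht0 : 0 < t := ht0
    rw [Pi.sub_apply, ht.deriv, hXx t (by linarith), hXx (t - τ) (by linarith),
      hXx (t - 2 * τ) (by linarith)]
    abel
  refine Integrable.mono' (g := fun t => K₁ * Real.exp (-(β * t))) ?_ hmeas ?_
  · have := (integrableOn_exp_mul_Ioi (a := -β) (by linarith) 0).const_mul K₁
    simpa only [neg_mul] using this
  · filter_upwards [ae_restrict_mem measurableSet_Ioi] with t ht
    exact hh t (le_of_lt ht)

/-- Freezing `x` to the left of `-2τ` gives global continuity and leaves the equation unchanged,
since for `t > 0` no delayed argument falls below `-2τ`. -/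
theorem IsSolution.scalarSystem {c₁ c₃ r₂ r₄ τ K₁ β : ℝ} {φ h x : ℝ → Fin 2 → ℝ}
    (hc₁ : 0 < c₁) (hc₃ : 0 < c₃) (hr₂ : 0 < r₂) (hr₄ : 0 < r₄) (hτ : 0 < τ)
    (hφ : ContinuousOn φ (Icc (-(2 * τ)) 0)) (hK : 0 < K₁) (hβ : 0 < β)
    (hh : ∀ t, 0 ≤ t → ‖h t‖ ≤ K₁ * Real.exp (-(β * t)))
    (hx : IsSolution c₁ c₃ r₂ r₄ τ φ h x) :
    ScalarSystem (a₁ c₁ c₃) (a₁ c₁ c₃ - a₂ c₁ c₃) r₂ r₄ τ β K₁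
      (fun t => x (max t (-(2 * τ))) 0) (fun t => x (max t (-(2 * τ))) 1)
      (fun t => h t 0) (fun t => h t 1) := by
  have hX := hx.continuous_extend hτ hφ
  have hXx : ∀ t, -(2 * τ) ≤ t → x (max t (-(2 * τ))) = x t := fun t ht => by simp [ht]
  have hac : ∀ i t, 0 ≤ t →
      AbsolutelyContinuousOnInterval (fun t => x (max t (-(2 * τ))) i) 0 t := fun i t ht => by
    refine absolutelyContinuousOnInterval_congr
      (absolutelyContinuousOnInterval_apply (hx.absCont t ht) i) fun r hr => ?_
    rw [uIcc_of_le ht] at hr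
    simp only [hXx r (by linarith [hr.1])]
  have heq : ∀ᵐ t, 0 < t → ∀ i, HasDerivAt (fun t => x (max t (-(2 * τ))) i)
      ((matA c₁ c₃ r₂ r₄ *ᵥ x (max t (-(2 * τ)))
        + matB c₁ c₃ r₂ r₄ *ᵥ x (max (t - τ) (-(2 * τ)))
        + matC c₁ c₃ r₄ *ᵥ x (max (t - 2 * τ) (-(2 * τ))) + h t) i) t := by
    have := (ae_restrict_iff' measurableSet_Ioi).1 hx.equation
    filter_upwards [this] with t ht ht0 i
    rw [hXx t (by linarith), hXx (t - τ) (by linarith), hXx (t - 2 * τ) (by linarith)]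
    refine (hasDerivAt_pi.1 (ht ht0) i).congr_of_eventuallyEq ?_
    filter_upwards [Ioi_mem_nhds ht0] with r hr
    have hr : 0 < r := hr
    rw [hXx r (by linarith)]
  refine ⟨a₁_pos hc₁ hc₃, a₁_lt hc₁ hc₃, hr₂, hr₄, hτ, hβ, hK, (continuous_apply 0).comp hX,
    (continuous_apply 1).comp hX, hac 0, hac 1,
    fun t ht => (norm_le_pi_norm (h t) 0).trans (hh t ht),
    fun t ht => (norm_le_pi_norm (h t) 1).trans (hh t ht), ?_, ?_⟩
  · filter_upwards [heq] with t ht ht0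
    refine (ht ht0 0).congr_deriv ?_
    simp [matA, matB, matC, dotProduct, Fin.sum_univ_two]
    ring
  · filter_upwards [heq] with t ht ht0
    refine (ht ht0 1).congr_deriv ?_
    simp [matA, matB, matC, dotProduct, Fin.sum_univ_two]
    ring

theorem intervalIntegral_apply {f : ℝ → Fin 2 → ℝ} {s t : ℝ} (hf : IntervalIntegrable f volume s t)
    (i : Fin 2) : (∫ r in s..t, f r) i = ∫ r in s..t, f r i :=
  ((ContinuousLinearMap.proj (R := ℝ) (φ := fun _ : Fin 2 => ℝ) i).intervalIntegral_comp_comm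
    hf).symm

theorem IsSolution.tendsto {c₁ c₃ r₂ r₄ τ K₁ β : ℝ} {φ h x : ℝ → Fin 2 → ℝ}
    (hc₁ : 0 < c₁) (hc₃ : 0 < c₃) (hr₂ : 0 < r₂) (hr₄ : 0 < r₄) (hτ : 0 < τ)
    (hφ : ContinuousOn φ (Icc (-(2 * τ)) 0)) (hK : 0 < K₁) (hβ : 0 < β)
    (hh : ∀ t, 0 ≤ t → ‖h t‖ ≤ K₁ * Real.exp (-(β * t)))
    (hx : IsSolution c₁ c₃ r₂ r₄ τ φ h x) :
    Tendsto x atTop (𝓝 (matM c₁ c₃ r₂ r₄ τ *ᵥ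
        (φ 0 + matB c₁ c₃ r₂ r₄ *ᵥ (∫ θ in (0 : ℝ)..τ, φ (θ - τ))
          + matC c₁ c₃ r₄ *ᵥ (∫ θ in (0 : ℝ)..(2 * τ), φ (θ - 2 * τ))
          + ∫ θ in Ioi (0 : ℝ), h θ))) := by
  have hint := hx.integrableOn hτ hφ hβ hh
  have hcomp : ∀ i, IntegrableOn (fun t => h t i) (Ioi 0) := fun i => hint.eval i
  have hI : ∀ i, (∫ θ in Ioi (0 : ℝ), h θ) i = ∫ θ in Ioi (0 : ℝ), h θ i := fun i =>
    (eval_integral (fun j => hcomp j) i)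
  have hφint : ∀ c, 0 ≤ c → c ≤ 2 * τ → ∀ i, (∫ θ in (0 : ℝ)..c, φ (θ - c)) i
      = ∫ r in (0 - c)..0, x (max r (-(2 * τ))) i := by
    intro c hc hcτ i
    rw [intervalIntegral.integral_comp_sub_right (fun r => φ r) c, sub_self]
    have hsub : uIcc (0 - c) 0 ⊆ Icc (-(2 * τ)) 0 := by
      rw [uIcc_of_le (by linarith)]
      exact Icc_subset_Icc (by linarith) le_rfl
    rw [intervalIntegral_apply ((hφ.mono hsub).intervalIntegrable) i]
    refine intervalIntegral.integral_congr fun r hr => ?_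
    have hr := hsub hr
    simp only [max_eq_left hr.1, hx.initial r hr]
  obtain ⟨h0, h1⟩ := (hx.scalarSystem hc₁ hc₃ hr₂ hr₄ hτ hφ hK hβ hh).tendsto_solution
    (hcomp 0) (hcomp 1)
  have hg : g₀ c₁ c₃ r₂ r₄ τ
      = a₁ c₁ c₃ * (r₂ + r₄ + 2 * τ * r₂ * r₄ * (a₁ c₁ c₃ - a₂ c₁ c₃)) := by
    unfold g₀
    ring
  have ha := (a₁_pos hc₁ hc₃).ne'
  have hD : r₂ + r₄ + 2 * τ * r₂ * r₄ * (a₁ c₁ c₃ - a₂ c₁ c₃) ≠ 0 := by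
    intro h
    have := g₀_pos hc₁ hc₃ hr₂ hr₄ hτ
    rw [hg, h, mul_zero] at this
    exact lt_irrefl _ this
  have hini : x (max 0 (-(2 * τ))) = φ 0 := by
    rw [max_eq_left (by linarith)]
    exact hx.initial 0 ⟨by linarith, le_rfl⟩
  have hev : ∀ i, (fun t => x (max t (-(2 * τ))) i) =ᶠ[atTop] fun t => x t i := fun i => by
    filter_upwards [eventually_ge_atTop (-(2 * τ))] with t ht
    rw [max_eq_left ht]
  simp only [ScalarSystem.firstIntegral, hini] at h0 h1
  rw [← hφint τ hτ.le (by linarith) 0, ← hφint τ hτ.le (by linarith) 1,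
    ← hφint (2 * τ) (by linarith) le_rfl 1, ← hI 0, ← hI 1] at h0 h1
  rw [tendsto_pi_nhds]
  intro i
  fin_cases i
  · refine (h0.congr' (hev 0)).trans (le_of_eq (congrArg 𝓝 ?_))
    simp [matM, matB, matC, Matrix.mulVec, dotProduct, Fin.sum_univ_two, Matrix.vecHead,
      Matrix.vecTail, hg]
    field_simp
    ring
  · refine (h1.congr' (hev 1)).trans (le_of_eq (congrArg 𝓝 ?_))
    simp [matM, matB, matC, Matrix.mulVec, dotProduct, Fin.sum_univ_two, Matrix.vecHead,
      Matrix.vecTail, hg]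
    field_simp
    ring

end TwoLayer

theorem corollaryl (c₁ c₃ r₂ r₄ τ : ℝ) (hc₁ : 0 < c₁) (hc₃ : 0 < c₃)
    (hr₂ : 0 < r₂) (hr₄ : 0 < r₄) (hτ : 0 < τ) :
    -- `M` has rank one and is the residue at `s = 0` of `e^{st} Δ(s)⁻¹`, for every `t`
    (TwoLayer.matM c₁ c₃ r₂ r₄ τ).rank = 1 ∧
    (∀ t : ℝ, TwoLayer.HasSimplePoleResidue
      (fun s => Complex.exp (s * t) • (TwoLayer.charMatrix c₁ c₃ r₂ r₄ τ s)⁻¹) 0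
      ((TwoLayer.matM c₁ c₃ r₂ r₄ τ).map Complex.ofReal)) ∧
    -- the limit of the solution
    ∀ φ h x : ℝ → Fin 2 → ℝ,
      ContinuousOn φ (Icc (-(2 * τ)) 0) →
      (∃ K₁ > 0, ∃ β > 0, ∀ t : ℝ, 0 ≤ t → ‖h t‖ ≤ K₁ * Real.exp (-(β * t))) →
      TwoLayer.IsSolution c₁ c₃ r₂ r₄ τ φ h x →
      IntegrableOn h (Ioi 0) ∧
      Tendsto x atTop (𝓝 (TwoLayer.matM c₁ c₃ r₂ r₄ τ *ᵥ
        (φ 0 + TwoLayer.matB c₁ c₃ r₂ r₄ *ᵥ (∫ θ in (0 : ℝ)..τ, φ (θ - τ))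
          + TwoLayer.matC c₁ c₃ r₄ *ᵥ (∫ θ in (0 : ℝ)..(2 * τ), φ (θ - 2 * τ))
          + ∫ θ in Ioi (0 : ℝ), h θ))) := by

  refine ⟨TwoLayer.rank_matM hc₁ hc₃ hr₂ hr₄ hτ,
    TwoLayer.hasSimplePoleResidue_charMatrix_inv hc₁ hc₃ hr₂ hr₄ hτ, ?_⟩
  rintro φ h x hφ ⟨K₁, hK, β, hβ, hh⟩ hx
  exact ⟨hx.integrableOn hτ hφ hβ hh, hx.tendsto hc₁ hc₃ hr₂ hr₄ hτ hφ hK hβ hh⟩
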